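/- Let $E$ be a finite-dimensional complex vector space and $V\subset E$ a real form, that is, a real linear subspace with $E=V\oplus iV$. Let $F\subset V$ be a connected, locally closed (that is, embedded) real-analytic submanifold, let $T=V+iF\subset E$ be the tube over $F$, and let $a\in T$. For a real submanifold $M\subset E$ and $b\in M$ denote by $T_bM\subset E$ the tangent space and by $H_bM=T_bM\cap iT_bM$ the holomorphic tangent space of $M$ at $b$. Say that $M$ is *of finite type at $a\in M$* if the Lie algebra of vector fields generated by the smooth local sections of $HM$ near $a$ has at $a$ all of $T_aM$ as its set of values, and that $M$ is *minimal at $a\in M$* if every smooth submanifold $N\subset M$ with $a\in N$ and $H_bM\subset T_bN$ for all $b\in N$ is open in $M$. Then the following three conditions are equivalent: (i) $T$ is of finite type at $a$; (ii) $T$ is minimal at $a$; (iii) the smallest affine subspace of $V$ containing $F$ is $V$ itself. -/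

import Mathlib

open scoped ContDiff Pointwise Topology

/-- `M` is an embedded (hence locally closed) submanifold of class `C^n` and of dimension `d` of the
finite-dimensional real normed space `E`: near each of its points, `M` is mapped by a local
`C^n`-diffeomorphism of `E` to an open piece of a `d`-dimensional linear subspace.
Here `n = ∞` means smooth and `n = ω` means real-analytic. -/
def IsSubmanifold {E : Type*} [NormedAddCommGroup E] [NormedSpace ℝ E]
    (n : WithTop ℕ∞) (d : ℕ) (M : Set E) : Prop :=
  ∀ a ∈ M, ∃ (W : Submodule ℝ E) (Φ : OpenPartialHomeomorph E E),
    Module.finrank ℝ W = d ∧ a ∈ Φ.source ∧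
    ContDiffOn ℝ n Φ Φ.source ∧ ContDiffOn ℝ n Φ.symm Φ.target ∧
    ∀ x ∈ Φ.source, x ∈ M ↔ Φ x ∈ W

/-- The tangent space `T_a M`, as a real linear subspace of the ambient space: the velocities at
`a` of curves in `M`. For a submanifold `M` these velocities form a linear subspace already, and
`Submodule.span` only bundles it. -/
def tangentSpaceAt {E : Type*} [NormedAddCommGroup E] [NormedSpace ℝ E]
    (M : Set E) (a : E) : Submodule ℝ E :=
  Submodule.span ℝ {v | ∃ γ : ℝ → E, γ 0 = a ∧ HasDerivAt γ v 0 ∧ ∀ᶠ t in 𝓝 (0 : ℝ), γ t ∈ M}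

/-- The holomorphic tangent space `H_a M = T_a M ∩ i T_a M`. -/
noncomputable def holTangentSpaceAt {E : Type*} [NormedAddCommGroup E] [NormedSpace ℂ E]
    (M : Set E) (a : E) : Submodule ℝ E :=
  tangentSpaceAt M a ⊓ Complex.I • tangentSpaceAt M a

/-- The Lie algebra of vector fields generated by the smooth local sections of the holomorphic
tangent bundle `H M` near `a`. Vector fields on `M` near `a` are represented by smooth extensions
to a neighbourhood of `a` in `E`; as all fields occurring here are tangent to `M`, the values of
their brackets along `M` do not depend on the extensions. -/
inductive CRLieAlgebraAt {E : Type*} [NormedAddCommGroup E] [NormedSpace ℂ E]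
    (M : Set E) (a : E) : (E → E) → Prop
  | section_mem (X : E → E) (hX : ∀ᶠ b in 𝓝 a, ContDiffAt ℝ ∞ X b)
      (hH : ∀ᶠ b in 𝓝 a, b ∈ M → X b ∈ holTangentSpaceAt M b) : CRLieAlgebraAt M a X
  | add_mem (X Y : E → E) : CRLieAlgebraAt M a X → CRLieAlgebraAt M a Y →
      CRLieAlgebraAt M a (fun b => X b + Y b)
  | smul_mem (c : ℝ) (X : E → E) : CRLieAlgebraAt M a X → CRLieAlgebraAt M a (fun b => c • X b)
  | bracket_mem (X Y : E → E) : CRLieAlgebraAt M a X → CRLieAlgebraAt M a Y →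
      CRLieAlgebraAt M a (VectorField.lieBracket ℝ X Y)

/-- `M` is of finite type at `a`: the values at `a` of the Lie algebra generated by the smooth local
sections of `H M` exhaust `T_a M`. -/
def IsOfFiniteTypeAt {E : Type*} [NormedAddCommGroup E] [NormedSpace ℂ E]
    (M : Set E) (a : E) : Prop :=
  ∀ v ∈ tangentSpaceAt M a, ∃ X : E → E, CRLieAlgebraAt M a X ∧ X a = v

/-- `M` is minimal at `a`: every smooth submanifold `N ⊆ M` through `a` with `H_b M ⊆ T_b N` for
all `b ∈ N` is open in `M`. -/
def IsMinimalAt {E : Type*} [NormedAddCommGroup E] [NormedSpace ℂ E]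
    (M : Set E) (a : E) : Prop :=
  ∀ (d : ℕ) (N : Set E), IsSubmanifold ∞ d N → N ⊆ M → a ∈ N →
    (∀ b ∈ N, holTangentSpaceAt M b ≤ tangentSpaceAt N b) →
    ∃ U : Set E, IsOpen U ∧ N = M ∩ U

/-- The tube `V + iF` over the base `F ⊆ V`, where `V` is a real linear subspace of `E`. -/
def tube {E : Type*} [NormedAddCommGroup E] [NormedSpace ℂ E]
    (V : Submodule ℝ E) (F : Set V) : Set E :=
  {z | ∃ x : V, ∃ y ∈ F, z = (x : E) + Complex.I • (y : E)}

/-! ### Submanifolds, their tangent spaces, and inclusions in equal dimension. -/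

section Submanifold

variable {E : Type*} [NormedAddCommGroup E] [NormedSpace ℝ E]
  {E' : Type*} [NormedAddCommGroup E'] [NormedSpace ℝ E']

/-! (i) ⇒ (ii) holds for any submanifold `M`: if `N ⊆ M` and `HM ≤ TN` along `N`, then sections of
`HM`, and hence their brackets, are tangent to `N` (`CRLieAlgebraAt.eventually_tangent`). Finite
type then forces `T_a N = T_a M`, and a submanifold of the same dimension is relatively open.

(ii) ⇒ (iii): the holomorphic tangent space of the tube is `TF + iTF`. With `D` the direction of the
affine hull of `F` and `x` the real part of `a`, the set `(x + D) + iF` contains `a` and is tangent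
to all of it, because `TF ≤ D`. By minimality it is open in `V + iF`, so `D = V`.

(iii) ⇒ (i): let `Ψ = Φ.symm` parametrize `F` by a linear space `W`. For `w ∈ W` both `∂_w Ψ` and `i
∂_w Ψ` are sections of `HT`, and bracketing the latter with the real field `∂_w^k Ψ` gives
`∂_w^(k+1) Ψ` (`crLieAlgebraAt_tube_iteratedFDeriv`). If the values of these real fields did not
span `V`, some nonzero functional would kill all of them; by Taylor expansion it is constant on `F`
near the base point, by analyticity and connectedness on all of `F`, so `F` lies in a hyperplane.
The remaining directions `i TF` are values of sections. -/

theorem IsSubmanifold.of_le {n m : WithTop ℕ∞} {d : ℕ} {M : Set E} (hM : IsSubmanifold n d M)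
    (hmn : m ≤ n) : IsSubmanifold m d M := by
  intro a ha
  obtain ⟨W, Φ, hW, haΦ, h₁, h₂, h₃⟩ := hM a ha
  exact ⟨W, Φ, hW, haΦ, h₁.of_le hmn, h₂.of_le hmn, h₃⟩

theorem Submodule.finrank_prod_eq [FiniteDimensional ℝ E] [FiniteDimensional ℝ E']
    (W : Submodule ℝ E) (W' : Submodule ℝ E') :
    Module.finrank ℝ (W.prod W') = Module.finrank ℝ W + Module.finrank ℝ W' := by
  have h : W.prod W' = LinearMap.range (W.subtype.prodMap W'.subtype) := by
    rw [LinearMap.range_prodMap, Submodule.range_subtype, Submodule.range_subtype]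
  rw [h, LinearMap.finrank_range_of_inj, Module.finrank_prod]
  exact Prod.map_injective.2 ⟨W.injective_subtype, W'.injective_subtype⟩

theorem IsSubmanifold.prod [FiniteDimensional ℝ E] [FiniteDimensional ℝ E']
    {n : WithTop ℕ∞} {d d' : ℕ} {M : Set E} {M' : Set E'}
    (hM : IsSubmanifold n d M) (hM' : IsSubmanifold n d' M') :
    IsSubmanifold n (d + d') (M ×ˢ M') := by
  rintro ⟨a, a'⟩ ⟨ha, ha'⟩
  obtain ⟨W, Φ, hW, haΦ, h₁, h₂, h₃⟩ := hM a ha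
  obtain ⟨W', Φ', hW', haΦ', h₁', h₂', h₃'⟩ := hM' a' ha'
  refine ⟨W.prod W', Φ.prod Φ', ?_, ⟨haΦ, haΦ'⟩, ?_, ?_, ?_⟩
  · rw [Submodule.finrank_prod_eq, hW, hW']
  · exact h₁.prodMap h₁'
  · exact h₂.prodMap h₂'
  · rintro ⟨x, x'⟩ ⟨hx, hx'⟩
    exact and_congr (h₃ x hx) (h₃' x' hx')

theorem IsSubmanifold.image {n : WithTop ℕ∞} {d : ℕ} {M : Set E} (hM : IsSubmanifold n d M)
    (e : E ≃L[ℝ] E') : IsSubmanifold n d (e '' M) := by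
  rintro _ ⟨a, ha, rfl⟩
  obtain ⟨W, Φ, hW, haΦ, h₁, h₂, h₃⟩ := hM a ha
  refine ⟨W.map e.toLinearEquiv.toLinearMap,
    (e.symm.toHomeomorph.transOpenPartialHomeomorph Φ).transHomeomorph e.toHomeomorph,
    ?_, ?_, ?_, ?_, ?_⟩
  · rw [← hW]
    exact LinearEquiv.finrank_map_eq e.toLinearEquiv W
  · change e.symm (e a) ∈ Φ.source
    simpa using haΦ
  · exact e.contDiff.comp_contDiffOn (h₁.comp e.symm.contDiff.contDiffOn fun x hx => hx)
  · exact e.contDiff.comp_contDiffOn (h₂.comp e.symm.contDiff.contDiffOn fun x hx => hx)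
  · intro x hx
    have h := h₃ (e.symm x) hx
    have h4 : x ∈ e '' M ↔ e.symm x ∈ M := by
      constructor
      · rintro ⟨y, hy, rfl⟩
        simpa using hy
      · intro hy
        exact ⟨_, hy, by simp⟩
    rw [h4, h]
    change _ ↔ e (Φ (e.symm x)) ∈ _
    constructor
    · intro hy
      exact ⟨_, hy, rfl⟩
    · rintro ⟨y, hy, hye⟩
      have : y = Φ (e.symm x) := e.injective hye
      rwa [← this]

theorem isSubmanifold_setOf_sub_mem (n : WithTop ℕ∞) (D : Submodule ℝ E) (x₀ : E) :
    IsSubmanifold n (Module.finrank ℝ D) {x | x - x₀ ∈ D} := by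
  intro a ha
  refine ⟨D, (Homeomorph.subRight x₀).toOpenPartialHomeomorph, rfl, trivial, ?_, ?_, ?_⟩
  · exact (contDiff_id.sub contDiff_const).contDiffOn
  · exact (contDiff_id.add contDiff_const).contDiffOn
  · intro x _
    exact Iff.rfl

theorem tangentSpaceAt_mono {M N : Set E} (h : N ⊆ M) (a : E) :
    tangentSpaceAt N a ≤ tangentSpaceAt M a := by
  apply Submodule.span_mono
  rintro v ⟨γ, h₀, hd, hγ⟩
  exact ⟨γ, h₀, hd, hγ.mono fun t ht => h ht⟩

theorem map_mem_tangentSpaceAt {M : Set E} {M' : Set E'} {f : E → E'} {f' : E →L[ℝ] E'} {a : E}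
    (hf : HasFDerivAt f f' a) (hM : ∀ᶠ x in 𝓝 a, x ∈ M → f x ∈ M') {v : E}
    (hv : v ∈ tangentSpaceAt M a) : f' v ∈ tangentSpaceAt M' (f a) := by
  have : tangentSpaceAt M a ≤ (tangentSpaceAt M' (f a)).comap f'.toLinearMap := by
    refine Submodule.span_le.2 ?_
    rintro v ⟨γ, h₀, hd, hγ⟩
    refine Submodule.subset_span ⟨f ∘ γ, by simp [h₀], ?_, ?_⟩
    · subst h₀
      exact hf.comp_hasDerivAt 0 hd
    · have hc : Filter.Tendsto γ (𝓝 0) (𝓝 a) := h₀ ▸ hd.continuousAt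
      filter_upwards [hγ, hc.eventually hM] with t h1 h2 using h2 h1
  exact this hv

theorem tangentSpaceAt_setOf_sub_mem [FiniteDimensional ℝ E] (D : Submodule ℝ E) (x₀ a : E) :
    tangentSpaceAt {x | x - x₀ ∈ D} a ≤ D := by
  refine Submodule.span_le.2 ?_
  rintro v ⟨γ, h₀, hd, hγ⟩
  by_contra hv
  -- A functional that kills `D` but not `v` is constant along the curve, so its derivative `f v`
  -- must vanish.
  obtain ⟨f, hfv, hf⟩ := Submodule.exists_le_ker_of_notMem hv
  have h1 : HasDerivAt (fun t => f.toContinuousLinearMap (γ t - x₀))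
      (f.toContinuousLinearMap v) 0 :=
    f.toContinuousLinearMap.hasFDerivAt.comp_hasDerivAt 0 (hd.sub_const x₀)
  have h2 : (fun t => f.toContinuousLinearMap (γ t - x₀)) =ᶠ[𝓝 0] fun _ => 0 :=
    hγ.mono fun t ht => hf ht
  exact hfv (h1.unique ((hasDerivAt_const 0 (0 : ℝ)).congr_of_eventuallyEq h2))

theorem le_tangentSpaceAt_setOf_sub_mem (D : Submodule ℝ E) {x₀ a : E} (ha : a - x₀ ∈ D) :
    D ≤ tangentSpaceAt {x | x - x₀ ∈ D} a := by
  intro v hv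
  refine Submodule.subset_span ⟨fun t => a + t • v, by simp, ?_, .of_forall fun t => ?_⟩
  · simpa using ((hasDerivAt_id (0 : ℝ)).smul_const v).const_add a
  · change a + t • v - x₀ ∈ D
    rw [add_sub_right_comm]
    exact D.add_mem ha (D.smul_mem t hv)

theorem tangentSpaceAt_prod {M : Set E} {M' : Set E'} {p : E × E'} (hp : p ∈ M ×ˢ M') :
    tangentSpaceAt (M ×ˢ M') p = (tangentSpaceAt M p.1).prod (tangentSpaceAt M' p.2) := by
  obtain ⟨a, a'⟩ := p
  obtain ⟨ha, ha'⟩ := hp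
  apply le_antisymm
  · intro v hv
    exact ⟨map_mem_tangentSpaceAt (M' := M) hasFDerivAt_fst (.of_forall fun x hx => hx.1) hv,
      map_mem_tangentSpaceAt (M' := M') hasFDerivAt_snd (.of_forall fun x hx => hx.2) hv⟩
  · rintro ⟨v, v'⟩ ⟨hv, hv'⟩
    have h1 : (v, (0 : E')) ∈ tangentSpaceAt (M ×ˢ M') (a, a') :=
      map_mem_tangentSpaceAt (M := M) (M' := M ×ˢ M') (f := fun x => (x, a')) (hasFDerivAt_prodMk_left a a')
        (.of_forall fun x hx => ⟨hx, ha'⟩) hv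
    have h2 : ((0 : E), v') ∈ tangentSpaceAt (M ×ˢ M') (a, a') :=
      map_mem_tangentSpaceAt (M := M') (M' := M ×ˢ M') (f := fun x => (a, x)) (hasFDerivAt_prodMk_right a a')
        (.of_forall fun x hx => ⟨ha, hx⟩) hv'
    simpa using Submodule.add_mem _ h1 h2

theorem mem_tangentSpaceAt_image_iff (e : E ≃L[ℝ] E') {M : Set E} {a v : E} :
    e v ∈ tangentSpaceAt (e '' M) (e a) ↔ v ∈ tangentSpaceAt M a := by
  constructor
  · intro h
    have := map_mem_tangentSpaceAt (M' := M) (e.symm.hasFDerivAt (x := e a))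
      (.of_forall ?_) h
    · simpa using this
    · rintro _ ⟨y, hy, rfl⟩
      simpa using hy
  · exact map_mem_tangentSpaceAt (M := M) (M' := e '' M) e.hasFDerivAt (.of_forall fun x hx => ⟨x, hx, rfl⟩)

/-- Chain rule for the two compositions of `Φ` and `Φ.symm`. Strict derivatives are recorded because
the open mapping argument below needs them. -/
theorem OpenPartialHomeomorph.exists_hasStrictFDerivAt_equiv {n : WithTop ℕ∞} (hn : n ≠ 0)
    (Φ : OpenPartialHomeomorph E E) (h₁ : ContDiffOn ℝ n Φ Φ.source)
    (h₂ : ContDiffOn ℝ n Φ.symm Φ.target) {a : E} (ha : a ∈ Φ.source) :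
    ∃ A : E ≃L[ℝ] E, HasStrictFDerivAt Φ (A : E →L[ℝ] E) a ∧
      HasStrictFDerivAt Φ.symm (A.symm : E →L[ℝ] E) (Φ a) := by
  have d₁ : HasStrictFDerivAt Φ (fderiv ℝ Φ a) a :=
    (h₁.contDiffAt (Φ.open_source.mem_nhds ha)).hasStrictFDerivAt hn
  have d₂ : HasStrictFDerivAt Φ.symm (fderiv ℝ Φ.symm (Φ a)) (Φ a) :=
    (h₂.contDiffAt (Φ.open_target.mem_nhds (Φ.map_source ha))).hasStrictFDerivAt hn
  have e₁ : (fderiv ℝ Φ.symm (Φ a)).comp (fderiv ℝ Φ a) = ContinuousLinearMap.id ℝ E := by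
    refine (d₂.hasFDerivAt.comp a d₁.hasFDerivAt).unique
      ((hasFDerivAt_id a).congr_of_eventuallyEq ?_)
    filter_upwards [Φ.open_source.mem_nhds ha] with x hx using Φ.left_inv hx
  have e₂ : (fderiv ℝ Φ a).comp (fderiv ℝ Φ.symm (Φ a)) = ContinuousLinearMap.id ℝ E := by
    have d₁' : HasFDerivAt Φ (fderiv ℝ Φ a) (Φ.symm (Φ a)) := by
      rw [Φ.left_inv ha]
      exact d₁.hasFDerivAt
    refine (d₁'.comp (Φ a) d₂.hasFDerivAt).unique
      ((hasFDerivAt_id (Φ a)).congr_of_eventuallyEq ?_)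
    filter_upwards [Φ.open_target.mem_nhds (Φ.map_source ha)] with x hx using Φ.right_inv hx
  exact ⟨ContinuousLinearEquiv.equivOfInverse _ _ (fun x => DFunLike.congr_fun e₁ x)
    (fun x => DFunLike.congr_fun e₂ x), d₁, d₂⟩

/-- The chart and its inverse carry curves in `M` to curves in `W` and back. -/
theorem tangentSpaceAt_eq_comap_chart [FiniteDimensional ℝ E] {M : Set E} {W : Submodule ℝ E}
    {Φ : OpenPartialHomeomorph E E} (hM : ∀ x ∈ Φ.source, x ∈ M ↔ Φ x ∈ W) {a : E}
    (ha : a ∈ Φ.source) (haM : a ∈ M) {A : E ≃L[ℝ] E}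
    (hA : HasStrictFDerivAt Φ (A : E →L[ℝ] E) a)
    (hA' : HasStrictFDerivAt Φ.symm (A.symm : E →L[ℝ] E) (Φ a)) :
    tangentSpaceAt M a = W.comap (A : E →ₗ[ℝ] E) := by
  apply le_antisymm
  · intro v hv
    have h := map_mem_tangentSpaceAt (M' := {x | x - 0 ∈ W}) hA.hasFDerivAt ?_ hv
    · exact tangentSpaceAt_setOf_sub_mem W 0 _ h
    · filter_upwards [Φ.open_source.mem_nhds ha] with x hx hxM
      simpa using (hM x hx).1 hxM
  · intro v hv
    have hv' : A v ∈ W := hv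
    have h0 : Φ a - 0 ∈ W := by simpa using (hM a ha).1 haM
    have h := map_mem_tangentSpaceAt (M' := M) hA'.hasFDerivAt ?_
      (le_tangentSpaceAt_setOf_sub_mem W h0 hv')
    · simpa [Φ.left_inv ha] using h
    · filter_upwards [Φ.open_target.mem_nhds (Φ.map_source ha)] with x hx hxW
      refine (hM _ (Φ.map_target hx)).2 ?_
      rw [Φ.right_inv hx]
      simpa using hxW

theorem IsSubmanifold.finrank_tangentSpaceAt [FiniteDimensional ℝ E] {n : WithTop ℕ∞}
    (hn : n ≠ 0) {d : ℕ} {M : Set E} (hM : IsSubmanifold n d M) {a : E} (ha : a ∈ M) :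
    Module.finrank ℝ (tangentSpaceAt M a) = d := by
  obtain ⟨W, Φ, hW, haΦ, h₁, h₂, h₃⟩ := hM a ha
  obtain ⟨A, hA, hA'⟩ := Φ.exists_hasStrictFDerivAt_equiv hn h₁ h₂ haΦ
  rw [tangentSpaceAt_eq_comap_chart h₃ haΦ ha hA hA', ← hW]
  have : W.comap (A : E →ₗ[ℝ] E) = W.map (A.symm.toLinearEquiv : E →ₗ[ℝ] E) := by
    ext x
    constructor
    · intro hx
      exact ⟨A x, hx, by simp⟩
    · rintro ⟨y, hy, rfl⟩
      simpa using hy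
  rw [this]
  exact LinearEquiv.finrank_map_eq A.symm.toLinearEquiv W

theorem fderiv_apply_eq_zero_of_mem_tangentSpaceAt {N : Set E} {f : E → ℝ} {a v : E}
    (hf : DifferentiableAt ℝ f a) (h0 : ∀ᶠ x in 𝓝 a, x ∈ N → f x = 0)
    (hv : v ∈ tangentSpaceAt N a) : fderiv ℝ f a v = 0 := by
  have h := map_mem_tangentSpaceAt (M' := {x : ℝ | x - 0 ∈ (⊥ : Submodule ℝ ℝ)}) hf.hasFDerivAt
    (h0.mono fun x hx hxN => by simpa using hx hxN) hv
  simpa using tangentSpaceAt_setOf_sub_mem _ _ _ h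

/-- A submanifold contained in a submanifold of the same dimension is relatively open in it. -/
theorem IsSubmanifold.exists_isOpen_of_subset [FiniteDimensional ℝ E] {n m : WithTop ℕ∞}
    (hn : n ≠ 0) (hm : m ≠ 0) {d : ℕ} {M N : Set E} (hM : IsSubmanifold n d M)
    (hN : IsSubmanifold m d N) (hNM : N ⊆ M) : ∃ U : Set E, IsOpen U ∧ N = M ∩ U := by
  suffices h : ∀ b ∈ N, ∀ᶠ x in 𝓝 b, x ∈ M → x ∈ N by
    refine ⟨interior {x | x ∈ M → x ∈ N}, isOpen_interior, Set.Subset.antisymm ?_ ?_⟩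
    · exact fun b hb => ⟨hNM hb, mem_interior_iff_mem_nhds.2 (h b hb)⟩
    · exact fun b hb => interior_subset hb.2 hb.1
  intro b hb
  obtain ⟨W, Φ, hW, haΦ, h₁, h₂, h₃⟩ := hN b hb
  obtain ⟨Z, Ψ, hZ, haΨ, k₁, k₂, k₃⟩ := hM b (hNM hb)
  obtain ⟨A, hA, hA'⟩ := Φ.exists_hasStrictFDerivAt_equiv hm h₁ h₂ haΦ
  obtain ⟨B, hB, hB'⟩ := Ψ.exists_hasStrictFDerivAt_equiv hn k₁ k₂ haΨ
  have tN := tangentSpaceAt_eq_comap_chart h₃ haΦ hb hA hA'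
  have tM := tangentSpaceAt_eq_comap_chart k₃ haΨ (hNM hb) hB hB'
  -- Projecting to `Z` turns the change of charts into a map `W → Z` between spaces of equal
  -- dimension. Its derivative is injective because `T_b N ≤ T_b M`, hence surjective, so the map is
  -- open at `Φ b`.
  obtain ⟨P₀, hP₀⟩ := Z.exists_isCompl
  obtain ⟨P, hP⟩ : ∃ P : E →L[ℝ] Z, ∀ z : Z, P z = z :=
    ⟨(Z.projectionOnto P₀ hP₀).toContinuousLinearMap,
      fun z => Submodule.projectionOnto_apply_left hP₀ z⟩
  have hw : Φ b ∈ W := (h₃ b haΦ).1 hb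
  have hB1 : HasStrictFDerivAt Ψ (B : E →L[ℝ] E) (Φ.symm (Φ b)) := by rwa [Φ.left_inv haΦ]
  have hf : HasStrictFDerivAt (fun w : W => P (Ψ (Φ.symm w)))
      (P ∘L (B : E →L[ℝ] E) ∘L (A.symm : E →L[ℝ] E) ∘L W.subtypeL) ⟨Φ b, hw⟩ :=
    P.hasStrictFDerivAt.comp _ (HasStrictFDerivAt.comp _ (g := Ψ) hB1
      (HasStrictFDerivAt.comp _ (g := Φ.symm) (f := fun w : W => (w : E)) hA'
        W.subtypeL.hasStrictFDerivAt))
  have hmem : ∀ w : W, B (A.symm w) ∈ Z := by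
    intro w
    have h1 : A.symm (w : E) ∈ tangentSpaceAt N b := by
      rw [tN]
      simp
    have h2 := tangentSpaceAt_mono hNM b h1
    rw [tM] at h2
    exact h2
  have hinj : Function.Injective
      (P ∘L (B : E →L[ℝ] E) ∘L (A.symm : E →L[ℝ] E) ∘L W.subtypeL).toLinearMap := by
    intro w w' hww
    have hww' : P (B (A.symm w)) = P (B (A.symm w')) := hww
    have e1 := hP ⟨_, hmem w⟩
    have e2 := hP ⟨_, hmem w'⟩
    dsimp only at e1 e2
    rw [e1, e2] at hww'
    exact Subtype.ext (A.symm.injective (B.injective (Subtype.ext_iff.1 hww')))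
  have hsurj := (LinearMap.injective_iff_surjective_of_finrank_eq_finrank (hW.trans hZ.symm)).1 hinj
  have hmap := hf.map_nhds_eq_of_surj (LinearMap.range_eq_top.2 hsurj)
  have hS : ∀ᶠ w : W in 𝓝 ⟨Φ b, hw⟩, (w : E) ∈ Φ.target ∧ Φ.symm w ∈ Ψ.source := by
    have hc : Filter.Tendsto (fun w : W => (w : E)) (𝓝 ⟨Φ b, hw⟩) (𝓝 (Φ b)) :=
      continuous_subtype_val.continuousAt
    have h1 := hc.eventually (Φ.open_target.mem_nhds (Φ.map_source haΦ))
    have h2 : Filter.Tendsto Φ.symm (𝓝 (Φ b)) (𝓝 b) := by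
      simpa [Φ.left_inv haΦ] using (Φ.continuousAt_symm (Φ.map_source haΦ)).tendsto
    exact h1.and ((h2.comp hc).eventually (Ψ.open_source.mem_nhds haΨ))
  have hI := Filter.image_mem_map (m := fun w : W => P (Ψ (Φ.symm w))) hS
  rw [hmap] at hI
  have hc : Filter.Tendsto (fun x => P (Ψ x)) (𝓝 b) (𝓝 (P (Ψ (Φ.symm (Φ b))))) := by
    rw [Φ.left_inv haΦ]
    exact (P.continuous.continuousAt.comp (Ψ.continuousAt haΨ)).tendsto
  -- A point `x ∈ M` near `b` has the same `Z`-coordinate as some point of `N`; as `Ψ` is injective,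
  -- the two points coincide.
  filter_upwards [hc hI, Ψ.open_source.mem_nhds haΨ] with x hx hxs hxM
  obtain ⟨w, ⟨hwt, hws⟩, hwx⟩ := hx
  have hwN : Φ.symm w ∈ N := by
    rw [h₃ _ (Φ.map_target hwt), Φ.right_inv hwt]
    exact w.2
  have e1 := hP ⟨_, (k₃ _ hws).1 (hNM hwN)⟩
  have e2 := hP ⟨_, (k₃ _ hxs).1 hxM⟩
  dsimp only at e1 e2 hwx
  rw [e1, e2] at hwx
  rw [← Ψ.injOn hws hxs (Subtype.ext_iff.1 hwx)]
  exact hwN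

end Submanifold

/-! ### Finite type implies minimality. -/

section FiniteType

/-- Tangency to `N` passes to brackets: if `h` vanishes on `N` near `b`, so do `Xh` and `Yh`, and
then `dh [X, Y]`, a difference of derivatives of these along `X` and `Y`, vanishes at `b`. The test
functions `h` are functionals killing `W`, composed with a chart. Smoothness is part of the
induction, and both claims hold near `a` so that they can be differentiated. -/
theorem CRLieAlgebraAt.eventually_tangent {E : Type*} [NormedAddCommGroup E] [NormedSpace ℂ E]
    [FiniteDimensional ℝ E] {M N : Set E} {d : ℕ} (hN : IsSubmanifold ∞ d N) (hNM : N ⊆ M)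
    (hH : ∀ b ∈ N, holTangentSpaceAt M b ≤ tangentSpaceAt N b) {a : E} {X : E → E}
    (hX : CRLieAlgebraAt M a X) :
    ∀ᶠ b in 𝓝 a, ContDiffAt ℝ ∞ X b ∧ (b ∈ N → X b ∈ tangentSpaceAt N b) := by
  induction hX with
  | section_mem X hX hXH =>
    filter_upwards [hX, hXH] with b h1 h2 using ⟨h1, fun hb => hH b hb (h2 (hNM hb))⟩
  | add_mem X Y _ _ hX hY =>
    filter_upwards [hX, hY] with b h1 h2
    exact ⟨h1.1.add h2.1, fun hb => Submodule.add_mem _ (h1.2 hb) (h2.2 hb)⟩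
  | smul_mem c X _ hX =>
    filter_upwards [hX] with b h1
    exact ⟨contDiffAt_const.smul h1.1, fun hb => Submodule.smul_mem _ c (h1.2 hb)⟩
  | bracket_mem X Y _ _ hX hY =>
    filter_upwards [hX.eventually_nhds, hY.eventually_nhds] with b h1 h2
    have hXb := h1.self_of_nhds.1
    have hYb := h2.self_of_nhds.1
    refine ⟨hXb.lieBracket_vectorField hYb (by simp), fun hb => ?_⟩
    obtain ⟨W, Φ, hW, hbΦ, h₁, h₂, h₃⟩ := hN b hb
    obtain ⟨A, hA, hA'⟩ := Φ.exists_hasStrictFDerivAt_equiv (by simp) h₁ h₂ hbΦ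
    rw [tangentSpaceAt_eq_comap_chart h₃ hbΦ hb hA hA']
    by_contra hv
    obtain ⟨f, hfv, hf⟩ := Submodule.exists_le_ker_of_notMem (p := W) hv
    set h : E → ℝ := fun x => f.toContinuousLinearMap (Φ x) with hh
    have hsm : ∀ x ∈ Φ.source, ContDiffAt ℝ ∞ h x := fun x hx =>
      f.toContinuousLinearMap.contDiff.contDiffAt.comp x
        (h₁.contDiffAt (Φ.open_source.mem_nhds hx))
    have h0 : ∀ᶠ x in 𝓝 b, ∀ᶠ y in 𝓝 x, y ∈ N → h y = 0 := by
      refine Filter.Eventually.eventually_nhds ?_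
      filter_upwards [Φ.open_source.mem_nhds hbΦ] with x hx hxN
      exact hf ((h₃ x hx).1 hxN)
    have hdiff : ∀ Z : E → E, ContDiffAt ℝ ∞ Z b →
        DifferentiableAt ℝ (fun x => fderiv ℝ h x (Z x)) b := fun Z hZ =>
      (((hsm b hbΦ).fderiv_right (m := 1) (by norm_cast)).differentiableAt
        (by simp)).clm_apply (hZ.differentiableAt (by simp))
    have hvan : ∀ Z : E → E,
        (∀ᶠ x in 𝓝 b, ContDiffAt ℝ ∞ Z x ∧ (x ∈ N → Z x ∈ tangentSpaceAt N x)) →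
        ∀ᶠ x in 𝓝 b, x ∈ N → fderiv ℝ h x (Z x) = 0 := by
      intro Z hZ
      filter_upwards [hZ, h0, Φ.open_source.mem_nhds hbΦ] with x hx hx0 hxs hxN
      exact fderiv_apply_eq_zero_of_mem_tangentSpaceAt
        ((hsm x hxs).differentiableAt (by simp)) hx0 (hx.2 hxN)
    have key := VectorField.fderiv_apply_lieBracket (hsm b hbΦ)
      (by simp [minSmoothness_of_isRCLikeNormedField]; norm_cast)
      (hYb.differentiableAt (by simp)) (hXb.differentiableAt (by simp))
    rw [fderiv_apply_eq_zero_of_mem_tangentSpaceAt (hdiff Y hYb) (hvan Y h2)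
        (h1.self_of_nhds.2 hb),
      fderiv_apply_eq_zero_of_mem_tangentSpaceAt (hdiff X hXb) (hvan X h1)
        (h2.self_of_nhds.2 hb), sub_zero] at key
    have hd : HasFDerivAt h (f.toContinuousLinearMap ∘L (A : E →L[ℝ] E)) b :=
      f.toContinuousLinearMap.hasFDerivAt.comp b hA.hasFDerivAt
    rw [hd.fderiv] at key
    exact hfv key

theorem IsOfFiniteTypeAt.isMinimalAt {E : Type*} [NormedAddCommGroup E] [NormedSpace ℂ E]
    [FiniteDimensional ℝ E] {M : Set E} {n : WithTop ℕ∞} (hn : n ≠ 0) {d : ℕ}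
    (hM : IsSubmanifold n d M) {a : E} (h : IsOfFiniteTypeAt M a) : IsMinimalAt M a := by
  intro k N hN hNM haN hH
  have hle : tangentSpaceAt M a ≤ tangentSpaceAt N a := by
    intro v hv
    obtain ⟨X, hX, rfl⟩ := h v hv
    exact (hX.eventually_tangent hN hNM hH).self_of_nhds.2 haN
  have hk : k = d := by
    rw [← hN.finrank_tangentSpaceAt (by simp) haN, ← hM.finrank_tangentSpaceAt hn (hNM haN),
      le_antisymm hle (tangentSpaceAt_mono hNM a)]
  subst hk
  exact hM.exists_isOpen_of_subset hn (by simp) hN hNM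

end FiniteType

/-! ### Linear functionals on analytic submanifolds. -/

section Analytic

variable {E : Type*} [NormedAddCommGroup E] [NormedSpace ℝ E] [FiniteDimensional ℝ E]

/-- The identity theorem on the slice of the ball by `W`, which is convex and so connected. The
centre `p` is kept apart from `Φ y` so that constancy can spread from a nearby point to the centre.
-/
theorem eqOn_of_chart_of_eventually_eq {F : Set E} {W : Submodule ℝ E}
    {Φ : OpenPartialHomeomorph E E} (h₂ : ContDiffOn ℝ ω Φ.symm Φ.target)
    (h₃ : ∀ x ∈ Φ.source, x ∈ F ↔ Φ x ∈ W) {p : E} {r : ℝ}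
    (hr : Metric.ball p r ⊆ Φ.target) (f : E →L[ℝ] ℝ) {y : E} (hy : y ∈ F) (hys : y ∈ Φ.source)
    (hyr : Φ y ∈ Metric.ball p r) (h : ∀ᶠ x in 𝓝[F] y, f x = f y) :
    ∀ x ∈ F, x ∈ Φ.source → Φ x ∈ Metric.ball p r → f x = f y := by
  have : CompleteSpace E := FiniteDimensional.complete ℝ E
  set g : W → ℝ := fun w => f (Φ.symm w) with hg
  set U : Set W := {w | (w : E) ∈ Metric.ball p r} with hU
  have hgan : AnalyticOnNhd ℝ g U := by
    intro w hw
    have h1 : AnalyticAt ℝ Φ.symm (W.subtypeL w) :=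
      (h₂.contDiffAt (Φ.open_target.mem_nhds (hr hw))).analyticAt
    exact (f.analyticAt _).comp (h1.comp (W.subtypeL.analyticAt w))
  have hUc : IsPreconnected U :=
    ((convex_ball p r).linear_preimage W.subtype).isPreconnected
  have hyW : Φ y ∈ W := (h₃ y hys).1 hy
  have hev : g =ᶠ[𝓝 ⟨Φ y, hyW⟩] fun _ => f y := by
    have hc : Filter.Tendsto (fun w : W => Φ.symm w) (𝓝 ⟨Φ y, hyW⟩) (𝓝 y) := by
      have h2 : Filter.Tendsto Φ.symm (𝓝 (Φ y)) (𝓝 y) := by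
        simpa [Φ.left_inv hys] using (Φ.continuousAt_symm (Φ.map_source hys)).tendsto
      exact h2.comp continuous_subtype_val.continuousAt
    have ht : ∀ᶠ w : W in 𝓝 ⟨Φ y, hyW⟩, (w : E) ∈ Φ.target :=
      continuous_subtype_val.continuousAt.eventually
        (Φ.open_target.mem_nhds (Φ.map_source hys))
    filter_upwards [hc.eventually (eventually_nhdsWithin_iff.1 h), ht] with w hw hwt
    refine hw ((h₃ _ (Φ.map_target hwt)).2 ?_)
    rw [Φ.right_inv hwt]
    exact w.2
  have heq := hgan.eqOn_of_preconnected_of_eventuallyEq analyticOnNhd_const hUc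
    (z₀ := ⟨Φ y, hyW⟩) hyr hev
  intro x hx hxs hxr
  have := heq (x := ⟨Φ x, (h₃ x hxs).1 hx⟩) hxr
  simpa [hg, Φ.left_inv hxs] using this

/-- A linear functional that is constant near one point of a connected real-analytic submanifold
is constant on it. -/
theorem IsSubmanifold.eq_of_eventually_eq {d : ℕ} {F : Set E} (hF : IsSubmanifold ω d F)
    (hc : IsPreconnected F) (f : E →L[ℝ] ℝ) {y₀ : E} (hy₀ : y₀ ∈ F)
    (h : ∀ᶠ x in 𝓝[F] y₀, f x = f y₀) : ∀ x ∈ F, f x = f y₀ := by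
  have : PreconnectedSpace F := Subtype.preconnectedSpace hc
  set A : Set F := {y | ∀ᶠ x : F in 𝓝 y, f x = f y} with hA
  have hAopen : IsOpen A := by
    refine isOpen_iff_mem_nhds.2 fun y hy => ?_
    have hy' : ∀ᶠ x : F in 𝓝 y, f x = f y := hy
    filter_upwards [hy'.eventually_nhds] with z hz
    filter_upwards [hz] with x hx
    rw [hx, hz.self_of_nhds]
  have hAclosed : IsClosed A := by
    refine isClosed_of_closure_subset fun y hy => ?_
    obtain ⟨W, Φ, hW, hyΦ, h₁, h₂, h₃⟩ := hF y y.2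
    obtain ⟨r, hr0, hr⟩ := Metric.isOpen_iff.1 Φ.open_target _ (Φ.map_source hyΦ)
    have hU : ∀ᶠ x : F in 𝓝 y, (x : E) ∈ Φ.source ∧ Φ x ∈ Metric.ball (Φ y) r := by
      have hcv : Filter.Tendsto (fun x : F => (x : E)) (𝓝 y) (𝓝 y) :=
        continuous_subtype_val.continuousAt
      exact (hcv.eventually (Φ.open_source.mem_nhds hyΦ)).and
        (((Φ.continuousAt hyΦ).tendsto.comp hcv).eventually (Metric.ball_mem_nhds _ hr0))
    -- A point of `A` inside a chart ball around the limit point `y` makes `f` constant on that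
    -- whole piece of `F`, including near `y`.
    obtain ⟨z, ⟨hzs, hzr⟩, hzA⟩ := mem_closure_iff_nhds.1 hy _ hU
    have hz : ∀ᶠ x in 𝓝[F] (z : E), f x = f z :=
      (eventually_nhds_subtype_iff F z fun x => f x = f z).1 hzA
    have key := eqOn_of_chart_of_eventually_eq h₂ h₃ hr f z.2 hzs hzr hz
    change ∀ᶠ x : F in 𝓝 y, f x = f y
    filter_upwards [hU] with x hx
    rw [key x x.2 hx.1 hx.2, key y y.2 hyΦ (Metric.mem_ball_self hr0)]
  have hAuniv : A = Set.univ := IsClopen.eq_univ ⟨hAclosed, hAopen⟩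
    ⟨⟨y₀, hy₀⟩, (eventually_nhds_subtype_iff F ⟨y₀, hy₀⟩ fun x => f x = f y₀).2 h⟩
  have hlc : IsLocallyConstant fun y : F => f y := by
    refine (IsLocallyConstant.iff_eventually_eq _).2 fun y => ?_
    have : y ∈ A := hAuniv ▸ Set.mem_univ y
    exact this
  exact fun x hx => hlc.apply_eq_of_preconnectedSpace ⟨x, hx⟩ ⟨y₀, hy₀⟩

/-- If all directional derivatives of `f ∘ Φ.symm` along `W` vanish at `Φ y`, then `f` is constant
on `F` near `y`. -/
theorem eventually_eq_of_iteratedFDeriv_eq_zero {F : Set E} {W : Submodule ℝ E}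
    {Φ : OpenPartialHomeomorph E E} (h₂ : ContDiffOn ℝ ω Φ.symm Φ.target)
    (h₃ : ∀ x ∈ Φ.source, x ∈ F ↔ Φ x ∈ W) (f : E →L[ℝ] ℝ) {y : E} (hy : y ∈ F)
    (hys : y ∈ Φ.source)
    (h : ∀ k : ℕ, ∀ w ∈ W, f (iteratedFDeriv ℝ (k + 1) Φ.symm (Φ y) fun _ => w) = 0) :
    ∀ᶠ x in 𝓝[F] y, f x = f y := by
  have : CompleteSpace E := FiniteDimensional.complete ℝ E
  have han : AnalyticAt ℝ Φ.symm (Φ y) :=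
    (h₂.contDiffAt (Φ.open_target.mem_nhds (Φ.map_source hys))).analyticAt
  obtain ⟨p, r, hp⟩ := han
  have hev : ∀ᶠ x in 𝓝 y, x ∈ Φ.source ∧ Φ x ∈ Metric.eball (Φ y) r :=
    (Φ.open_source.eventually_mem hys).and
      ((Φ.continuousAt hys).eventually (Metric.eball_mem_nhds _ hp.r_pos))
  refine eventually_nhdsWithin_iff.2 ?_
  filter_upwards [hev] with x hx hxF
  have hxW : Φ x - Φ y ∈ W := W.sub_mem ((h₃ x hx.1).1 hxF) ((h₃ y hys).1 hy)
  -- Taylor expansion of `Φ.symm` in the single direction `Φ x - Φ y ∈ W`: only diagonal values of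
  -- the derivatives occur, and `f` kills all but the constant term.
  have hs := hp.hasSum_iteratedFDeriv (y := Φ x - Φ y) (by
    simpa [edist_eq_enorm_sub] using hx.2)
  have hs' := f.hasSum hs
  rw [add_sub_cancel, Φ.left_inv hx.1] at hs'
  have h0 := hasSum_single (f := fun k => f ((k.factorial : ℝ)⁻¹ •
    iteratedFDeriv ℝ k Φ.symm (Φ y) fun _ => Φ x - Φ y)) 0 fun k hk => by
      obtain ⟨j, rfl⟩ := Nat.exists_eq_succ_of_ne_zero hk
      simp [h j _ hxW]
  simpa [Φ.left_inv hys] using hs'.unique h0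

end Analytic

/-! ### Tubes in the coordinates `V × V` of real and imaginary parts. -/

section Tube

variable {E : Type*} [NormedAddCommGroup E] [NormedSpace ℂ E]

/-- The difference of two fields with the same germ is zero near `a`, hence itself a section of
`HM`. -/
theorem CRLieAlgebraAt.congr {M : Set E} {a : E} {X Y : E → E} (hX : CRLieAlgebraAt M a X)
    (h : Y =ᶠ[𝓝 a] X) : CRLieAlgebraAt M a Y := by
  have h0 : (fun b => Y b - X b) =ᶠ[𝓝 a] fun _ => 0 := h.mono fun b hb => sub_eq_zero.2 hb
  have hZ : CRLieAlgebraAt M a fun b => Y b - X b := by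
    refine .section_mem _ ?_ ?_
    · filter_upwards [h0.eventually_nhds] with b hb using contDiffAt_const.congr_of_eventuallyEq hb
    · filter_upwards [h0] with b hb _
      rw [hb]
      exact zero_mem _
  simpa using hX.add_mem _ _ hZ

variable [FiniteDimensional ℂ E]

/-- The decomposition of `E` into real and imaginary parts with respect to a real form `V`. -/
noncomputable def realFormEquiv (V : Submodule ℝ E) (hV : IsCompl V (Complex.I • V)) :
    (V × V) ≃L[ℝ] E :=
  have : FiniteDimensional ℝ E := FiniteDimensional.complexToReal E
  (LinearEquiv.ofBijective
    (V.subtype.coprod (Complex.I • V.subtype)) <| by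
    constructor
    · refine (injective_iff_map_eq_zero _).2 ?_
      rintro ⟨x, y⟩ hxy
      have h : (x : E) + Complex.I • (y : E) = 0 := by simpa using hxy
      have h1 : (x : E) ∈ Complex.I • V := by
        rw [eq_neg_of_add_eq_zero_left h, ← smul_neg]
        exact Submodule.smul_mem_pointwise_smul _ _ _ (V.neg_mem y.2)
      have hx : (x : E) = 0 := (Submodule.disjoint_def.1 hV.disjoint) _ x.2 h1
      rw [hx, zero_add, smul_eq_zero_iff_right Complex.I_ne_zero] at h
      exact Prod.ext (Subtype.ext hx) (Subtype.ext h)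
    · intro z
      obtain ⟨x, hx, y, hy, rfl⟩ := Submodule.mem_sup.1
        (hV.sup_eq_top ▸ Submodule.mem_top : z ∈ V ⊔ Complex.I • V)
      obtain ⟨y, hyV, rfl⟩ := (Submodule.mem_smul_pointwise_iff_exists _ _ _).1 hy
      exact ⟨(⟨x, hx⟩, ⟨y, hyV⟩), by simp⟩).toContinuousLinearEquiv

variable {V : Submodule ℝ E} (hV : IsCompl V (Complex.I • V))

theorem realFormEquiv_apply (p : V × V) :
    realFormEquiv V hV p = (p.1 : E) + Complex.I • (p.2 : E) := by
  rfl

theorem tube_eq_image (F : Set V) :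
    tube V F = realFormEquiv V hV '' ({x | x - 0 ∈ (⊤ : Submodule ℝ V)} ×ˢ F) := by
  ext z
  constructor
  · rintro ⟨x, y, hy, rfl⟩
    exact ⟨(x, y), ⟨trivial, hy⟩, realFormEquiv_apply hV _⟩
  · rintro ⟨⟨x, y⟩, ⟨_, hy⟩, rfl⟩
    exact ⟨x, y, hy, realFormEquiv_apply hV _⟩

theorem mem_tangentSpaceAt_image_prod_iff {F : Set V} {D : Submodule ℝ V} {x₀ : V} {p v : V × V}
    (hp₁ : p.1 - x₀ ∈ D) (hp₂ : p.2 ∈ F) :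
    realFormEquiv V hV v ∈ tangentSpaceAt (realFormEquiv V hV '' ({x | x - x₀ ∈ D} ×ˢ F))
      (realFormEquiv V hV p) ↔ v.1 ∈ D ∧ v.2 ∈ tangentSpaceAt F p.2 := by
  have : FiniteDimensional ℝ E := FiniteDimensional.complexToReal E
  rw [mem_tangentSpaceAt_image_iff, tangentSpaceAt_prod ⟨hp₁, hp₂⟩, Submodule.mem_prod,
    le_antisymm (tangentSpaceAt_setOf_sub_mem D x₀ p.1) (le_tangentSpaceAt_setOf_sub_mem D hp₁)]

theorem mem_tangentSpaceAt_tube_iff {F : Set V} {p v : V × V} (hp : p.2 ∈ F) :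
    realFormEquiv V hV v ∈ tangentSpaceAt (tube V F) (realFormEquiv V hV p) ↔
      v.2 ∈ tangentSpaceAt F p.2 := by
  rw [tube_eq_image hV, mem_tangentSpaceAt_image_prod_iff hV (D := ⊤) (x₀ := 0) Submodule.mem_top hp]
  simp

/-- The tangent space of the tube is `V + iTF`; multiplication by `i` exchanges real and imaginary
parts up to sign, so the intersection constrains both. -/
theorem mem_holTangentSpaceAt_tube_iff {F : Set V} {p v : V × V} (hp : p.2 ∈ F) :
    realFormEquiv V hV v ∈ holTangentSpaceAt (tube V F) (realFormEquiv V hV p) ↔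
      v.1 ∈ tangentSpaceAt F p.2 ∧ v.2 ∈ tangentSpaceAt F p.2 := by
  have key : realFormEquiv V hV v =
      Complex.I • realFormEquiv V hV (v.2, -v.1) := by
    simp only [realFormEquiv_apply, smul_add, smul_smul, Complex.I_mul_I]
    simp [add_comm]
  have hI : realFormEquiv V hV v ∈
      Complex.I • tangentSpaceAt (tube V F) (realFormEquiv V hV p) ↔
      realFormEquiv V hV (v.2, -v.1) ∈ tangentSpaceAt (tube V F) (realFormEquiv V hV p) := by
    rw [Submodule.mem_smul_pointwise_iff_exists]
    constructor
    · rintro ⟨z, hz, hzv⟩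
      rw [key] at hzv
      rwa [← smul_right_injective E Complex.I_ne_zero hzv]
    · exact fun h => ⟨_, h, key.symm⟩
  rw [holTangentSpaceAt, Submodule.mem_inf, hI, mem_tangentSpaceAt_tube_iff hV hp,
    mem_tangentSpaceAt_tube_iff hV hp]
  simp [and_comm]

include hV in
theorem IsSubmanifold.tube {n : WithTop ℕ∞} {d : ℕ} {F : Set V} (hF : IsSubmanifold n d F) :
    IsSubmanifold n (Module.finrank ℝ (⊤ : Submodule ℝ V) + d) (tube V F) := by
  have : FiniteDimensional ℝ E := FiniteDimensional.complexToReal E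
  rw [tube_eq_image hV]
  exact ((isSubmanifold_setOf_sub_mem n ⊤ 0).prod hF).image _

include hV in
theorem affineSpan_eq_top_of_isMinimalAt_tube {n : WithTop ℕ∞} (hn : ∞ ≤ n) {d : ℕ} {F : Set V}
    (hF : IsSubmanifold n d F) {a : E} (ha : a ∈ tube V F) (h : IsMinimalAt (tube V F) a) :
    affineSpan ℝ F = ⊤ := by
  have : FiniteDimensional ℝ E := FiniteDimensional.complexToReal E
  set D := vectorSpan ℝ F with hD
  rw [tube_eq_image hV] at ha
  obtain ⟨⟨x, y⟩, ⟨_, hy⟩, rfl⟩ := ha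
  replace hy : y ∈ F := hy
  rw [AffineSubspace.affineSpan_eq_top_iff_vectorSpan_eq_top_of_nonempty ℝ V V ⟨y, hy⟩]
  -- For `b ∈ F`, `F` lies in the affine subspace `b + D`.
  have hTD : ∀ b ∈ F, tangentSpaceAt F b ≤ D := fun b hb =>
    (tangentSpaceAt_mono (fun c hc => vsub_mem_vectorSpan ℝ hc hb) b).trans
      (tangentSpaceAt_setOf_sub_mem D b b)
  have hN := ((isSubmanifold_setOf_sub_mem ∞ D x).prod (hF.of_le hn)).image (realFormEquiv V hV)
  have hsub : realFormEquiv V hV '' ({z | z - x ∈ D} ×ˢ F) ⊆ tube V F := by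
    rintro _ ⟨⟨x', y'⟩, ⟨_, hy'⟩, rfl⟩
    exact ⟨x', y', hy', realFormEquiv_apply hV _⟩
  have hH : ∀ b ∈ realFormEquiv V hV '' ({z | z - x ∈ D} ×ˢ F),
      holTangentSpaceAt (tube V F) b ≤
        tangentSpaceAt (realFormEquiv V hV '' ({z | z - x ∈ D} ×ˢ F)) b := by
    rintro _ ⟨p, ⟨hp₁, hp₂⟩, rfl⟩ z hz
    obtain ⟨v, rfl⟩ := (realFormEquiv V hV).surjective z
    rw [mem_holTangentSpaceAt_tube_iff hV hp₂] at hz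
    exact (mem_tangentSpaceAt_image_prod_iff hV hp₁ hp₂).2 ⟨hTD _ hp₂ hz.1, hz.2⟩
  obtain ⟨U, hU, hNU⟩ := h _ _ hN hsub ⟨(x, y), ⟨by simp, hy⟩, rfl⟩ hH
  refine Submodule.eq_top_iff'.2 fun u => ?_
  have ha : realFormEquiv V hV (x, y) ∈ U := by
    have : realFormEquiv V hV (x, y) ∈ realFormEquiv V hV '' ({z | z - x ∈ D} ×ˢ F) :=
      ⟨(x, y), ⟨by simp, hy⟩, rfl⟩
    rw [hNU] at this
    exact this.2
  -- Translating by a small real multiple of any `u ∈ V` stays in the tube, hence in its open piece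
  -- `(x + D) + iF`; a nonzero multiple then puts `u` in `D`.
  have hc : Filter.Tendsto (fun t : ℝ => realFormEquiv V hV (x + t • u, y)) (𝓝 0)
      (𝓝 (realFormEquiv V hV (x, y))) := by
    have : Continuous fun t : ℝ => realFormEquiv V hV (x + t • u, y) := by fun_prop
    simpa using this.tendsto 0
  obtain ⟨t, ht, ht0⟩ := ((hc.mono_left nhdsWithin_le_nhds).eventually (hU.mem_nhds ha)
    |>.and (self_mem_nhdsWithin : {t : ℝ | t ≠ 0} ∈ 𝓝[≠] 0)).exists
  have hmem : realFormEquiv V hV (x + t • u, y) ∈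
      realFormEquiv V hV '' ({z | z - x ∈ D} ×ˢ F) := by
    rw [hNU]
    exact ⟨⟨_, y, hy, realFormEquiv_apply hV _⟩, ht⟩
  have hmem' := ((realFormEquiv V hV).injective.mem_set_image.1 hmem).1
  have htu : t • u ∈ D := by simpa using hmem'
  exact (D.smul_mem_iff ht0).1 htu

/-- The coefficients depend only on the imaginary part, so the real field differentiates the
imaginary one to zero and a single term of the bracket survives. -/
theorem lieBracket_imaginary_real {g₁ g₂ : V → V} {z : E}
    (h₁ : DifferentiableAt ℝ g₁ ((realFormEquiv V hV).symm z).2)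
    (h₂ : DifferentiableAt ℝ g₂ ((realFormEquiv V hV).symm z).2) :
    VectorField.lieBracket ℝ
      (fun z => realFormEquiv V hV (0, g₁ ((realFormEquiv V hV).symm z).2))
      (fun z => realFormEquiv V hV (g₂ ((realFormEquiv V hV).symm z).2, 0)) z =
    realFormEquiv V hV (fderiv ℝ g₂ ((realFormEquiv V hV).symm z).2
      (g₁ ((realFormEquiv V hV).symm z).2), 0) := by
  set e := realFormEquiv V hV
  have him : HasFDerivAt (fun z => (e.symm z).2)
      (ContinuousLinearMap.snd ℝ V V ∘L (e.symm : E →L[ℝ] V × V)) z :=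
    (ContinuousLinearMap.snd ℝ V V ∘L (e.symm : E →L[ℝ] V × V)).hasFDerivAt
  have d₁ : HasFDerivAt (fun z => e (0, g₁ (e.symm z).2))
      (((e : V × V →L[ℝ] E) ∘L ContinuousLinearMap.inr ℝ V V) ∘L (fderiv ℝ g₁ (e.symm z).2) ∘L
        (ContinuousLinearMap.snd ℝ V V ∘L (e.symm : E →L[ℝ] V × V))) z :=
    ((e : V × V →L[ℝ] E) ∘L ContinuousLinearMap.inr ℝ V V).hasFDerivAt.comp z
      (h₁.hasFDerivAt.comp z him)
  have d₂ : HasFDerivAt (fun z => e (g₂ (e.symm z).2, 0))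
      (((e : V × V →L[ℝ] E) ∘L ContinuousLinearMap.inl ℝ V V) ∘L (fderiv ℝ g₂ (e.symm z).2) ∘L
        (ContinuousLinearMap.snd ℝ V V ∘L (e.symm : E →L[ℝ] V × V))) z :=
    ((e : V × V →L[ℝ] E) ∘L ContinuousLinearMap.inl ℝ V V).hasFDerivAt.comp z
      (h₂.hasFDerivAt.comp z him)
  rw [VectorField.lieBracket, d₁.fderiv, d₂.fderiv]
  simp

/-- Near a point over the domain of a chart `Φ` of `F`, the iterated derivatives of `Φ.symm` along
a direction of the chart give vector fields in the Lie algebra of the tube over `F`. -/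
theorem crLieAlgebraAt_tube_iteratedFDeriv {F : Set V} {W : Submodule ℝ V}
    {Φ : OpenPartialHomeomorph V V} (h₁ : ContDiffOn ℝ ω Φ Φ.source)
    (h₂ : ContDiffOn ℝ ω Φ.symm Φ.target) (h₃ : ∀ x ∈ Φ.source, x ∈ F ↔ Φ x ∈ W) {w : V}
    (hw : w ∈ W) {a : E} (ha : ((realFormEquiv V hV).symm a).2 ∈ Φ.source) :
    CRLieAlgebraAt (tube V F) a (fun z => realFormEquiv V hV
        (0, iteratedFDeriv ℝ 1 Φ.symm (Φ ((realFormEquiv V hV).symm z).2) fun _ => w)) ∧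
    ∀ k : ℕ, CRLieAlgebraAt (tube V F) a (fun z => realFormEquiv V hV
        (iteratedFDeriv ℝ (k + 1) Φ.symm (Φ ((realFormEquiv V hV).symm z).2) fun _ => w, 0)) := by
  have : FiniteDimensional ℝ E := FiniteDimensional.complexToReal E
  set e := realFormEquiv V hV
  have hGd : ∀ k : ℕ, ∀ q ∈ Φ.target, ContDiffAt ℝ ∞ (iteratedFDeriv ℝ k Φ.symm) q :=
    fun k q hq => ((h₂.contDiffAt (Φ.open_target.mem_nhds hq)).iteratedFDeriv_right
      (m := ω) le_top).of_le le_top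
  have hG : ∀ k : ℕ, ∀ q ∈ Φ.target,
      ContDiffAt ℝ ∞ (fun q => iteratedFDeriv ℝ k Φ.symm q fun _ => w) q := by
    intro k q hq
    let L : (V [×k]→L[ℝ] V) →L[ℝ] V := ContinuousMultilinearMap.apply ℝ _ _ fun _ => w
    exact L.contDiff.contDiffAt.comp q (hGd k q hq)
  have hΦ : ∀ x ∈ Φ.source, ContDiffAt ℝ ∞ Φ x := fun x hx =>
    (h₁.contDiffAt (Φ.open_source.mem_nhds hx)).of_le le_top
  have hGΦ : ∀ k : ℕ, ∀ x ∈ Φ.source,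
      ContDiffAt ℝ ∞ (fun x => iteratedFDeriv ℝ k Φ.symm (Φ x) fun _ => w) x := fun k x hx =>
    (hG k _ (Φ.map_source hx)).comp x (hΦ x hx)
  have hev : ∀ᶠ z in 𝓝 a, (e.symm z).2 ∈ Φ.source := by
    have : Continuous fun z => (e.symm z).2 := by fun_prop
    exact this.continuousAt.eventually (Φ.open_source.mem_nhds ha)
  have him : ContDiff ℝ ∞ fun z => (e.symm z).2 := contDiff_snd.comp e.symm.contDiff
  have hGz : ∀ k : ℕ, ∀ z, (e.symm z).2 ∈ Φ.source → ContDiffAt ℝ ∞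
      (fun z => iteratedFDeriv ℝ k Φ.symm (Φ (e.symm z).2) fun _ => w) z := fun k z hz =>
    (hGΦ k _ hz).comp (f := fun z => (e.symm z).2) z him.contDiffAt
  have htan : ∀ x ∈ Φ.source, x ∈ F →
      (iteratedFDeriv ℝ 1 Φ.symm (Φ x) fun _ => w) ∈ tangentSpaceAt F x := by
    intro x hx hxF
    obtain ⟨A, hA, hA'⟩ := Φ.exists_hasStrictFDerivAt_equiv (by simp) h₁ h₂ hx
    rw [tangentSpaceAt_eq_comap_chart h₃ hx hxF hA hA', iteratedFDeriv_one_apply,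
      hA'.hasFDerivAt.fderiv]
    simpa using hw
  have hmemF : ∀ z, z ∈ tube V F → (e.symm z).2 ∈ F := by
    rintro z hz
    rw [tube_eq_image hV] at hz
    obtain ⟨p, hp, rfl⟩ := hz
    simpa [e] using hp.2
  have hC : CRLieAlgebraAt (tube V F) a
      (fun z => e (0, iteratedFDeriv ℝ 1 Φ.symm (Φ (e.symm z).2) fun _ => w)) := by
    refine .section_mem _ ?_ ?_
    · filter_upwards [hev] with z hz
      exact e.contDiff.contDiffAt.comp z
        (contDiffAt_const.prodMk (hGz 1 z hz))
    · filter_upwards [hev] with z hz hzT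
      have h := (mem_holTangentSpaceAt_tube_iff hV (p := e.symm z)
        (v := (0, iteratedFDeriv ℝ 1 Φ.symm (Φ (e.symm z).2) fun _ => w)) (hmemF z hzT)).2
        ⟨zero_mem _, htan _ hz (hmemF z hzT)⟩
      simpa [e] using h
  refine ⟨hC, fun k => ?_⟩
  induction k with
  | zero =>
    refine .section_mem _ ?_ ?_
    · filter_upwards [hev] with z hz
      exact e.contDiff.contDiffAt.comp z
        ((hGz 1 z hz).prodMk contDiffAt_const)
    · filter_upwards [hev] with z hz hzT
      have h := (mem_holTangentSpaceAt_tube_iff hV (p := e.symm z)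
        (v := (iteratedFDeriv ℝ 1 Φ.symm (Φ (e.symm z).2) fun _ => w, 0)) (hmemF z hzT)).2
        ⟨htan _ hz (hmemF z hzT), zero_mem _⟩
      simpa [e] using h
  | succ k ih =>
    -- The imaginary field is `DΦ⁻¹ w`, which `Φ` straightens to the constant direction `w`;
    -- differentiating along it adds one more `w`. The formula holds only over the chart domain,
    -- hence the passage to germs.
    refine (hC.bracket_mem _ _ ih).congr ?_
    filter_upwards [hev] with z hz
    set x := (e.symm z).2 with hx
    rw [lieBracket_imaginary_real hV ((hGΦ 1 _ hz).differentiableAt (by simp))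
      ((hGΦ (k + 1) _ hz).differentiableAt (by simp))]
    congr 2
    obtain ⟨A, hA, hA'⟩ := Φ.exists_hasStrictFDerivAt_equiv (by simp) h₁ h₂ hz
    have hd : HasFDerivAt (fun x => iteratedFDeriv ℝ (k + 1) Φ.symm (Φ x) fun _ => w) _ x :=
      ((hG (k + 1) _ (Φ.map_source hz)).differentiableAt (by simp)).hasFDerivAt.comp x
        hA.hasFDerivAt
    rw [DifferentiableAt.iteratedFDeriv_succ_apply_left'
      ((hGd (k + 1) _ (Φ.map_source hz)).differentiableAt (by simp))]
    change _ = fderiv ℝ (fun x => iteratedFDeriv ℝ (k + 1) Φ.symm (Φ x) fun _ => w) x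
      (iteratedFDeriv ℝ 1 Φ.symm (Φ x) fun _ => w)
    rw [hd.fderiv, iteratedFDeriv_one_apply, hA'.hasFDerivAt.fderiv]
    simp [Fin.tail_def]

include hV in
theorem isOfFiniteTypeAt_tube_of_affineSpan_eq_top {d : ℕ} {F : Set V}
    (hF : IsSubmanifold ω d F) (hFc : IsPreconnected F) {a : E} (ha : a ∈ tube V F)
    (h : affineSpan ℝ F = ⊤) : IsOfFiniteTypeAt (tube V F) a := by
  have : FiniteDimensional ℝ E := FiniteDimensional.complexToReal E
  rw [tube_eq_image hV] at ha
  obtain ⟨⟨x, y⟩, ⟨_, hy⟩, rfl⟩ := ha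
  replace hy : y ∈ F := hy
  obtain ⟨W, Φ, hW, hyΦ, h₁, h₂, h₃⟩ := hF y hy
  have hsrc : ((realFormEquiv V hV).symm (realFormEquiv V hV (x, y))).2 ∈ Φ.source := by
    simpa using hyΦ
  -- `R` collects the purely real values at the base point of fields in the Lie algebra.
  let R : Submodule ℝ V :=
    { carrier := {u | ∃ X, CRLieAlgebraAt (tube V F) (realFormEquiv V hV (x, y)) X ∧
        X (realFormEquiv V hV (x, y)) = realFormEquiv V hV (u, 0)}
      add_mem' := by
        rintro u v ⟨X, hX, hXu⟩ ⟨Y, hY, hYv⟩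
        refine ⟨_, hX.add_mem _ _ hY, ?_⟩
        rw [hXu, hYv, ← map_add]
        simp
      zero_mem' := ⟨fun _ => 0, .section_mem _ (.of_forall fun _ => contDiffAt_const)
        (.of_forall fun _ _ => zero_mem _), by
          change (0 : E) = realFormEquiv V hV 0
          simp⟩
      smul_mem' := by
        rintro c u ⟨X, hX, hXu⟩
        refine ⟨_, hX.smul_mem c _, ?_⟩
        rw [hXu, ← map_smul]
        simp }
  have hR : R = ⊤ := by
    by_contra hR
    obtain ⟨f, hf0, hf⟩ := R.exists_le_ker_of_lt_top (lt_top_iff_ne_top.2 hR)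
    have hloc := eventually_eq_of_iteratedFDeriv_eq_zero h₂ h₃ f.toContinuousLinearMap hy hyΦ
      fun k w hw => hf ⟨_, (crLieAlgebraAt_tube_iteratedFDeriv hV h₁ h₂ h₃ hw hsrc).2 k, by simp⟩
    have hconst := hF.eq_of_eventually_eq hFc f.toContinuousLinearMap hy hloc
    rw [AffineSubspace.affineSpan_eq_top_iff_vectorSpan_eq_top_of_nonempty ℝ V V ⟨y, hy⟩] at h
    have hker : vectorSpan ℝ F ≤ LinearMap.ker f := by
      refine Submodule.span_le.2 ?_
      rintro _ ⟨b, hb, c, hc, rfl⟩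
      have h1 : f b = f y := hconst b hb
      have h2 : f c = f y := hconst c hc
      simp [h1, h2]
    rw [h] at hker
    exact hf0 (LinearMap.ker_eq_top.1 (top_le_iff.1 hker))
  intro z hz
  obtain ⟨⟨u, v⟩, rfl⟩ := (realFormEquiv V hV).surjective z
  have hv : v ∈ tangentSpaceAt F y := (mem_tangentSpaceAt_tube_iff hV (p := (x, y)) hy).1 hz
  obtain ⟨A, hA, hA'⟩ := Φ.exists_hasStrictFDerivAt_equiv (by simp) h₁ h₂ hyΦ
  rw [tangentSpaceAt_eq_comap_chart h₃ hyΦ hy hA hA'] at hv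
  obtain ⟨X, hX, hXu⟩ : u ∈ R := hR ▸ Submodule.mem_top
  -- The imaginary part `v` comes from the chart direction `A v ∈ W`, since the first derivative of
  -- `Φ.symm` sends `A v` back to `v`.
  refine ⟨_, hX.add_mem _ _ (crLieAlgebraAt_tube_iteratedFDeriv hV h₁ h₂ h₃ hv hsrc).1, ?_⟩
  simp only [hXu, ContinuousLinearEquiv.symm_apply_apply, iteratedFDeriv_one_apply,
    hA'.hasFDerivAt.fderiv]
  rw [← map_add]
  simp

end Tube

theorem mainTheorem9 {E : Type*} [NormedAddCommGroup E] [NormedSpace ℂ E] [FiniteDimensional ℂ E]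
    (V : Submodule ℝ E) (hV : IsCompl V (Complex.I • V))
    (d : ℕ) (F : Set V) (hF : IsSubmanifold ω d F) (hFconn : IsConnected F)
    (a : E) (ha : a ∈ tube V F) :
    List.TFAE [IsOfFiniteTypeAt (tube V F) a,
      IsMinimalAt (tube V F) a,
      affineSpan ℝ F = ⊤] := by
  have : FiniteDimensional ℝ E := FiniteDimensional.complexToReal E
  tfae_have 1 → 2 := fun h => h.isMinimalAt (by simp) (hF.tube hV)
  tfae_have 2 → 3 := affineSpan_eq_top_of_isMinimalAt_tube hV le_top hF ha
  tfae_have 3 → 1 := isOfFiniteTypeAt_tube_of_affineSpan_eq_top hV hF hFconn.isPreconnected ha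
  tfae_finish
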